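/- There exists a two-generated, recursively presented, bi-orderable solvable group of derived length $3$ whose word problem is undecidable. Explicitly, there is a group $G$ generated by two elements $x_1, x_2$ such that: (i) $G = \langle x_1, x_2 \mid R\rangle$ for some recursively enumerable set $R$ of words in $x_1^{\pm 1}, x_2^{\pm 1}$; (ii) there is a linear order on $G$ that is invariant under left and right multiplication; (iii) $G$ is solvable of derived length exactly $3$, i.e. $G^{(3)} = 1$ and $G^{(2)} \neq 1$; (iv) for every finite generating family $y_1,\dots,y_n$ of $G$, the set of words in $y_1^{\pm 1},\dots,y_n^{\pm 1}$ that represent the identity of $G$ is not recursive. -/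

import Mathlib

/-- The element of `G` represented by a word in the letters `x i` and `(x i)⁻¹`:
the letter `(i, true)` stands for `x i` and `(i, false)` for `(x i)⁻¹`. -/
def wordValue {G : Type*} [Group G] {ι : Type*} (x : ι → G) (w : List (ι × Bool)) : G :=
  FreeGroup.lift x (FreeGroup.mk w)

/-- The family `x` generates `G`. -/
def Generates {G : Type*} [Group G] {ι : Type*} (x : ι → G) : Prop :=
  Subgroup.closure (Set.range x) = ⊤

/-- `G` has a recursive presentation on the generating family `x`: there is a recursively
enumerable set `R` of words (relators) in the letters `x i`, `(x i)⁻¹` such that the kernel of the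
canonical epimorphism from the free group is the normal closure of `R`, i.e. `G = ⟨x | R⟩`. -/
def HasRecursivePresentation {G : Type*} [Group G] {ι : Type*} [Primcodable ι]
    (x : ι → G) : Prop :=
  Generates x ∧ ∃ R : Set (List (ι × Bool)), REPred (fun w => w ∈ R) ∧
    Subgroup.normalClosure (FreeGroup.mk '' R) = (FreeGroup.lift x).ker

/-- `G` is a computable group with respect to the generating family `x`: the set of words in
the letters `x i`, `(x i)⁻¹` that represent the identity is recursive. -/
def IsComputableWrt {G : Type*} [Group G] {ι : Type*} [Primcodable ι] (x : ι → G) : Prop :=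
  Generates x ∧ ComputablePred (fun w : List (ι × Bool) => wordValue x w = 1)

/-- `G` is computable with respect to some finite generating family. -/
def HasDecidableWordProblem (G : Type*) [Group G] : Prop :=
  ∃ (n : ℕ) (x : Fin n → G), IsComputableWrt x

/-- There is a linear order on `G` invariant under left and right multiplication. -/
def IsBiOrderable (G : Type*) [Group G] : Prop :=
  ∃ _ : LinearOrder G, ∀ a b c : G, a ≤ b → c * a ≤ c * b ∧ a * c ≤ b * c

/-- `G` is solvable of derived length exactly `l`. -/
def IsSolvableOfDerivedLength (G : Type*) [Group G] (l : ℕ) : Prop :=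
  derivedSeries G l = ⊥ ∧ ∀ k < l, derivedSeries G k ≠ ⊥

/-! The idea is P. Hall's: use a two-generated central extension of `ℤ ≀ ℤ` whose centre records a
set `S`. In `ℤ ≀ ℤ = ⟨t, u⟩` the conjugates of `u` by powers of `t` commute. In the extension, the
commutator `c_k` of `u` with its conjugate by `t ^ (k + 1)` becomes a central element, trivial
exactly when `k ∈ S` (`commutator_u_conj_eq_one_iff`).

The subgroup generated by `t` and `u` is presented by the relations "`c_k` is central" for all `k`
and `c_k = 1` for `k ∈ S` (`injective_of_relations`). Let `S` be the halting set: the relators are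
recursively enumerable, while deciding whether `c_k = 1` would decide halting. Over any finite
generating family, `c_k` is still given by a word computable from `k`, so the choice of generators
is irrelevant.

The three layers (shift, Laurent polynomial, central function) yield a lexicographic bi-order and
bound the derived length by 3; some `j ∉ S` shows that 3 is attained. -/

open LaurentPolynomial
open scoped commutatorElement

/-! ### The central extension of `ℤ ≀ ℤ` -/

/-- Restriction of the coefficients of `T ^ (k + 1)`, `k : ℕ`, of a Laurent polynomial
to the indices `k ∉ S`. -/
noncomputable def gapCoeff (S : Set ℕ) : ℤ[T;T⁻¹] →+ ({k : ℕ // k ∉ S} → ℤ) where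
  toFun f k := f.coeff ((k : ℕ) + 1)
  map_zero' := by ext; simp
  map_add' f g := by ext; simp

@[simp] theorem gapCoeff_apply (S : Set ℕ) (f : ℤ[T;T⁻¹]) (k : {k : ℕ // k ∉ S}) :
    gapCoeff S f k = f.coeff ((k : ℕ) + 1) := rfl

/-- A central extension of the wreath product `ℤ ≀ ℤ` by the group of integer valued
functions on the complement of `S`. -/
@[ext] structure HallGroup (S : Set ℕ) where
  shift : ℤ
  poly : ℤ[T;T⁻¹]
  central : {k : ℕ // k ∉ S} → ℤ

namespace HallGroup

variable {S : Set ℕ}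

/-- The cocycle comes from the pairings `∑ i, p_i * q_(i+k+1)`, the coefficients of `invert p * q`.
They are biadditive, and invariant under multiplying both arguments by `T n` because `invert` turns
`T n` into `T (-n)`; hence associativity. -/
noncomputable instance : Mul (HallGroup S) where
  mul a b := ⟨a.shift + b.shift, a.poly + T a.shift * b.poly,
    a.central + b.central + gapCoeff S (invert a.poly * (T a.shift * b.poly))⟩

noncomputable instance : One (HallGroup S) := ⟨⟨0, 0, 0⟩⟩

noncomputable instance : Inv (HallGroup S) where
  inv a := ⟨-a.shift, -(T (-a.shift) * a.poly),
    -a.central + gapCoeff S (invert a.poly * a.poly)⟩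

@[simp] theorem shift_mul (a b : HallGroup S) : (a * b).shift = a.shift + b.shift := rfl
@[simp] theorem poly_mul (a b : HallGroup S) :
    (a * b).poly = a.poly + T a.shift * b.poly := rfl
@[simp] theorem central_mul (a b : HallGroup S) : (a * b).central =
    a.central + b.central + gapCoeff S (invert a.poly * (T a.shift * b.poly)) := rfl
@[simp] theorem shift_one : (1 : HallGroup S).shift = 0 := rfl
@[simp] theorem poly_one : (1 : HallGroup S).poly = 0 := rfl
@[simp] theorem central_one : (1 : HallGroup S).central = 0 := rfl
@[simp] theorem shift_inv (a : HallGroup S) : a⁻¹.shift = -a.shift := rfl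
@[simp] theorem poly_inv (a : HallGroup S) : a⁻¹.poly = -(T (-a.shift) * a.poly) := rfl
@[simp] theorem central_inv (a : HallGroup S) :
    a⁻¹.central = -a.central + gapCoeff S (invert a.poly * a.poly) := rfl

theorem T_neg_mul_T (n : ℤ) : (T (-n) * T n : ℤ[T;T⁻¹]) = 1 := by
  rw [← T_add, neg_add_cancel, T_zero]

noncomputable instance : Group (HallGroup S) :=
  Group.ofLeftAxioms
    (by
      intro a b c
      ext1
      · simp [add_assoc]
      · simp [T_add, mul_add, add_assoc, mul_assoc, -T_mul]
      · simp only [central_mul, poly_mul, shift_mul, map_add, map_mul, invert_T, T_add]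
        have h : (invert a.poly + T (-a.shift) * invert b.poly) *
              (T a.shift * T b.shift * c.poly)
            = invert a.poly * (T a.shift * (T b.shift * c.poly)) +
              (T (-a.shift) * T a.shift) * (invert b.poly * (T b.shift * c.poly)) := by ring
        rw [h, T_neg_mul_T, one_mul, mul_add, mul_add, map_add, map_add]
        abel)
    (by
      intro a
      ext1 <;> simp)
    (by
      intro a
      ext1
      · simp
      · simp
      · simp only [central_mul, poly_inv, shift_inv, central_inv, central_one, map_neg, map_mul,
          invert_T, neg_neg]
        have h : -(T a.shift * invert a.poly) * (T (-a.shift) * a.poly)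
            = -((T (-a.shift) * T a.shift) * (invert a.poly * a.poly)) := by ring
        rw [h, T_neg_mul_T, one_mul, map_neg]
        abel)

/-- The projection to the infinite cyclic quotient. -/
noncomputable def shiftHom : HallGroup S →* Multiplicative ℤ where
  toFun a := Multiplicative.ofAdd a.shift
  map_one' := rfl
  map_mul' _ _ := rfl

/-! ### Generators and their commutators -/

/-- The first generator. -/
noncomputable def t : HallGroup S := ⟨1, 0, 0⟩

/-- The second generator. -/
noncomputable def u : HallGroup S := ⟨0, 1, 0⟩

@[simp] theorem t_shift : (t : HallGroup S).shift = 1 := rfl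
@[simp] theorem t_poly : (t : HallGroup S).poly = 0 := rfl
@[simp] theorem t_central : (t : HallGroup S).central = 0 := rfl
@[simp] theorem u_shift : (u : HallGroup S).shift = 0 := rfl
@[simp] theorem u_poly : (u : HallGroup S).poly = 1 := rfl
@[simp] theorem u_central : (u : HallGroup S).central = 0 := rfl

theorem t_zpow (n : ℤ) : (t : HallGroup S) ^ n = ⟨n, 0, 0⟩ := by
  induction n using Int.induction_on with
  | zero => rfl
  | succ n ih => rw [zpow_add_one, ih]; ext1 <;> simp
  | pred n ih => rw [zpow_sub_one, ih]; ext1 <;> simp [sub_eq_add_neg]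

theorem conj_t_zpow (n : ℤ) (a : HallGroup S) (ha : a.shift = 0) :
    t ^ n * a * (t ^ n)⁻¹ = ⟨0, T n * a.poly, a.central⟩ := by
  rw [t_zpow]
  ext1 <;> simp [ha]

/-- On shift zero the group is nilpotent of class at most two, so commutators are the
antisymmetrization of the cocycle. -/
theorem commutator_of_shift_eq_zero (a b : HallGroup S) (ha : a.shift = 0) (hb : b.shift = 0) :
    ⁅a, b⁆ = ⟨0, 0, gapCoeff S (invert a.poly * b.poly - invert b.poly * a.poly)⟩ := by
  rw [commutatorElement_def, mul_assoc, ← mul_inv_rev, mul_inv_eq_iff_eq_mul]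
  ext1
  · simp [ha, hb]
  · simp [ha, hb, add_comm]
  · simp [ha, hb, add_comm]

theorem commutator_u_conj (k : ℕ) :
    ⁅(u : HallGroup S), t ^ (k + 1) * u * (t ^ (k + 1))⁻¹⁆ =
      ⟨0, 0, gapCoeff S (T (k + 1))⟩ := by
  have := conj_t_zpow (S := S) (k + 1) u rfl
  rw [show ((k : ℤ) + 1) = ((k + 1 : ℕ) : ℤ) by push_cast; rfl, zpow_natCast] at this
  rw [this, commutator_of_shift_eq_zero _ _ rfl rfl]
  ext1
  · rfl
  · rfl
  · ext j
    -- The antisymmetric partner `T (-(k + 1))` is invisible: `gapCoeff` reads only positive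
    -- exponents.
    have : ¬ (-1 + -(k : ℤ) = (j : ℕ) + 1) := by omega
    simp [this]

theorem commute_of_central (a b : HallGroup S) (ha : a.shift = 0) (ha' : a.poly = 0) :
    Commute a b := by
  ext1 <;> simp [ha, ha', add_comm]

theorem gapCoeff_T_of_mem {k : ℕ} (hk : k ∈ S) : gapCoeff S (T (k + 1)) = 0 := by
  ext j
  have : ¬ ((k : ℤ) = (j : ℕ)) := fun h => j.2 (by rwa [← Nat.cast_injective h])
  simp [this]

theorem gapCoeff_T_of_notMem {k : ℕ} (hk : k ∉ S) :
    gapCoeff S (T (k + 1)) = Pi.single ⟨k, hk⟩ 1 := by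
  ext j
  simp [Pi.single_apply, Subtype.ext_iff, eq_comm]

theorem commutator_u_conj_eq_one_iff (k : ℕ) :
    ⁅(u : HallGroup S), (t ^ (k + 1) * u * (t ^ (k + 1))⁻¹ : HallGroup S)⁆ = 1 ↔ k ∈ S := by
  rw [commutator_u_conj]
  by_cases hk : k ∈ S
  · simp only [gapCoeff_T_of_mem hk, hk, iff_true]
    rfl
  · simp only [gapCoeff_T_of_notMem hk, hk, iff_false]
    intro h
    have := congrFun (congrArg central h) ⟨k, hk⟩
    simp at this

/-! ### The order -/

/-- The triple underlying an element, in the lexicographically ordered product. -/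
noncomputable def toLexTriple (a : HallGroup S) :
    ℤ ×ₗ (Lex (ℤ →₀ ℤ) ×ₗ Lex ({k : ℕ // k ∉ S} → ℤ)) :=
  toLex (a.shift, toLex (toLex a.poly.coeff, toLex a.central))

theorem toLexTriple_injective : Function.Injective (toLexTriple (S := S)) := by
  intro a b h
  simp only [toLexTriple, EmbeddingLike.apply_eq_iff_eq, Prod.mk.injEq] at h
  exact HallGroup.ext h.1 (LaurentPolynomial.ext fun n => by rw [h.2.1]) h.2.2

theorem coeff_T_mul (n m : ℤ) (f : ℤ[T;T⁻¹]) : (T n * f).coeff m = f.coeff (m - n) := by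
  rw [T, AddMonoidAlgebra.coeff_single_mul_apply, one_mul, neg_add_eq_sub]

/-- Translation of exponents preserves their order, so the first difference moves from `i` to `i +
n`. -/
theorem lex_T_mul_lt {f g : ℤ[T;T⁻¹]} (n : ℤ) (h : toLex f.coeff < toLex g.coeff) :
    toLex (T n * f).coeff < toLex (T n * g).coeff := by
  obtain ⟨i, hi, hlt⟩ := Finsupp.Lex.lt_iff.1 h
  refine Finsupp.Lex.lt_iff.2 ⟨i + n, fun j hj => ?_, ?_⟩
  · have := hi (j - n) (by omega)
    simpa [coeff_T_mul, -T_mul] using this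
  · simpa [coeff_T_mul, -T_mul] using hlt

theorem toLexTriple_lt_iff (a b : HallGroup S) : a.toLexTriple < b.toLexTriple ↔
    a.shift < b.shift ∨ a.shift = b.shift ∧ (toLex a.poly.coeff < toLex b.poly.coeff ∨
      a.poly = b.poly ∧ toLex a.central < toLex b.central) := by
  have : toLex a.poly.coeff = toLex b.poly.coeff ↔ a.poly = b.poly :=
    ⟨fun h => LaurentPolynomial.ext fun n => DFunLike.congr_fun (toLex.injective h) n, fun h => by rw [h]⟩
  simp only [toLexTriple, Prod.Lex.toLex_lt_toLex, this]

/-- The cocycle matters only once shifts and polynomials agree, and then it adds the same term to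
both sides. -/
theorem toLexTriple_mul_lt_mul_left (c : HallGroup S) {a b : HallGroup S}
    (h : a.toLexTriple < b.toLexTriple) : (c * a).toLexTriple < (c * b).toLexTriple := by
  rw [toLexTriple_lt_iff] at h ⊢
  rcases h with h | ⟨h, h' | ⟨h', h''⟩⟩
  · left; simpa using h
  · refine Or.inr ⟨by simp [h], Or.inl ?_⟩
    exact add_lt_add_right (lex_T_mul_lt c.shift h') (toLex c.poly.coeff)
  · refine Or.inr ⟨by simp [h], Or.inr ⟨by simp [h'], ?_⟩⟩
    simp only [central_mul, h', toLex_add]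
    gcongr

theorem toLexTriple_mul_lt_mul_right (c : HallGroup S) {a b : HallGroup S}
    (h : a.toLexTriple < b.toLexTriple) : (a * c).toLexTriple < (b * c).toLexTriple := by
  rw [toLexTriple_lt_iff] at h ⊢
  rcases h with h | ⟨h, h' | ⟨h', h''⟩⟩
  · left; simpa using h
  · refine Or.inr ⟨by simp [h], Or.inl ?_⟩
    simp only [poly_mul, h]
    exact add_lt_add_left h' (toLex (T b.shift * c.poly).coeff)
  · refine Or.inr ⟨by simp [h], Or.inr ⟨by simp [h, h'], ?_⟩⟩
    simp only [central_mul, h, h', toLex_add]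
    gcongr

theorem isBiOrderable : IsBiOrderable (HallGroup S) := by
  let _ : LinearOrder (HallGroup S) := LinearOrder.lift' toLexTriple toLexTriple_injective
  refine ⟨inferInstance, fun a b c h => ?_⟩
  change a.toLexTriple ≤ b.toLexTriple at h
  rcases h.lt_or_eq with h | h
  · exact ⟨(toLexTriple_mul_lt_mul_left c h).le, (toLexTriple_mul_lt_mul_right c h).le⟩
  · rw [toLexTriple_injective h]
    exact ⟨le_rfl, le_rfl⟩

/-! ### The derived series -/

theorem derivedSeries_one_le : derivedSeries (HallGroup S) 1 ≤ (shiftHom (S := S)).ker := by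
  rw [derivedSeries_one]
  exact Abelianization.commutator_subset_ker _

theorem mem_derivedSeries_two {a : HallGroup S} (ha : a ∈ derivedSeries (HallGroup S) 2) :
    a.shift = 0 ∧ a.poly = 0 := by
  rw [derivedSeries_succ] at ha
  refine (Subgroup.commutator_le (H₃ := ({
    carrier := {a | a.shift = 0 ∧ a.poly = 0}
    mul_mem' := ?_
    one_mem' := ⟨rfl, rfl⟩
    inv_mem' := ?_ } : Subgroup (HallGroup S)))).2 ?_ ha
  · rintro a b ⟨h1, h2⟩ ⟨h3, h4⟩
    simp_all
  · rintro a ⟨h1, h2⟩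
    simp_all
  · intro a ha b hb
    rw [commutator_of_shift_eq_zero a b (derivedSeries_one_le ha) (derivedSeries_one_le hb)]
    exact ⟨rfl, rfl⟩

theorem derivedSeries_three : derivedSeries (HallGroup S) 3 = ⊥ := by
  rw [derivedSeries_succ, eq_bot_iff, Subgroup.commutator_le]
  intro a ha b _
  have h := mem_derivedSeries_two ha
  exact commutatorElement_eq_one_iff_commute.2 (commute_of_central a b h.1 h.2)

/-- The central coordinate at `j` is the coefficient of `T (j + 1)` in the antisymmetrized pairing
of `T 1 - 1` with its translate, which is `2`. -/
theorem double_commutator_ne_one {j : ℕ} (hj : j ∉ S) :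
    ⁅⁅(t : HallGroup S), (u : HallGroup S)⁆,
      t ^ (j + 1) * ⁅(t : HallGroup S), (u : HallGroup S)⁆ * (t ^ (j + 1))⁻¹⁆ ≠ 1 := by
  have hp : ⁅(t : HallGroup S), (u : HallGroup S)⁆.poly = T 1 - 1 := by
    simp [commutatorElement_def, sub_eq_add_neg]
  have hs : ⁅(t : HallGroup S), (u : HallGroup S)⁆.shift = 0 := by
    simp [commutatorElement_def]
  have := conj_t_zpow (S := S) ((j + 1 : ℕ) : ℤ) ⁅t, (u : HallGroup S)⁆ hs
  rw [zpow_natCast] at this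
  rw [this, commutator_of_shift_eq_zero _ _ hs rfl, hp]
  intro h
  have := congrFun (congrArg central h) ⟨j, hj⟩
  simp only [central_one, Pi.zero_apply, gapCoeff_apply, map_sub, invert_T, map_one, map_mul] at this
  have e : (T (-1) - 1) * (T ((j + 1 : ℕ) : ℤ) * (T 1 - 1)) -
      T (-((j + 1 : ℕ) : ℤ)) * (T (-1) - 1) * (T 1 - 1) =
      2 * T ((j + 1 : ℕ) : ℤ) - T (j + 2) - T j - 2 * T (-((j + 1 : ℕ) : ℤ)) + T (-j)
        + (T (-j - 2) : ℤ[T;T⁻¹]) := by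
    rw [show (j : ℤ) + 2 = ((j + 1 : ℕ) : ℤ) + 1 by push_cast; ring,
      show (-(j : ℤ) - 2) = -((j + 1 : ℕ) : ℤ) + -1 by push_cast; ring,
      show T (j : ℤ) = (T ((j + 1 : ℕ) : ℤ) * T (-1) : ℤ[T;T⁻¹]) by
        rw [← T_add]; congr 1; push_cast; ring,
      show T (-(j : ℤ)) = (T (-((j + 1 : ℕ) : ℤ)) * T 1 : ℤ[T;T⁻¹]) by
        rw [← T_add]; congr 1; push_cast; ring, T_add, T_add]
    linear_combination (T ((j + 1 : ℕ) : ℤ) - T (-((j + 1 : ℕ) : ℤ)) : ℤ[T;T⁻¹]) * T_neg_mul_T 1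
  rw [e, two_mul, two_mul] at this
  have h1 : ¬ (-1 + -(j : ℤ) = j + 1) := by omega
  have h2 : ¬ (-(j : ℤ) = j + 1) := by omega
  have h3 : ¬ (-(j : ℤ) - 2 = j + 1) := by omega
  simp [h1, h2, h3] at this

end HallGroup

/-! ### The presentation of the subgroup generated by `t` and `u` -/

/-- Pairwise commuting elements of a group define a homomorphism from a free abelian group. -/
theorem exists_finsupp_hom_of_commute {α B : Type*} [Group B] (v : α → B)
    (hv : ∀ a b, Commute (v a) (v b)) :
    ∃ φ : Multiplicative (α →₀ ℤ) →* B,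
      ∀ a, φ (Multiplicative.ofAdd (Finsupp.single a 1)) = v a := by
  have hcomm : IsMulCommutative (Subgroup.closure (Set.range v)) :=
    Subgroup.isMulCommutative_closure (by rintro _ ⟨a, rfl⟩ _ ⟨b, rfl⟩; exact hv a b)
  let _ : CommGroup (Subgroup.closure (Set.range v)) :=
    { (inferInstance : Group (Subgroup.closure (Set.range v))) with
      mul_comm := hcomm.is_comm.comm }
  let ψ : (α →₀ ℤ) →+ Additive (Subgroup.closure (Set.range v)) :=
    Finsupp.liftAddHom fun a =>
      zmultiplesHom (Additive (Subgroup.closure (Set.range v))) (Additive.ofMul ⟨v a, Subgroup.subset_closure ⟨a, rfl⟩⟩)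
  refine ⟨(Subgroup.subtype _).comp (AddMonoidHom.toMultiplicativeLeft ψ), fun a => ?_⟩
  simp [ψ]

theorem commute_conj_zpow {B : Type*} [Group B] (t u : B)
    (h : ∀ k : ℕ, Commute u (t ^ (k + 1) * u * (t ^ (k + 1))⁻¹)) (m n : ℤ) :
    Commute (t ^ m * u * (t ^ m)⁻¹) (t ^ n * u * (t ^ n)⁻¹) := by
  -- Conjugating by `t ^ m` leaves only the difference of the exponents, which may be taken
  -- nonnegative.
  wlog hmn : m ≤ n generalizing m n
  · exact (this n m (by omega)).symm
  obtain ⟨d, rfl⟩ := Int.le.dest hmn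
  have : t ^ (m + (d : ℤ)) * u * (t ^ (m + (d : ℤ)))⁻¹ =
      t ^ m * (t ^ d * u * (t ^ d)⁻¹) * (t ^ m)⁻¹ := by
    rw [zpow_add, zpow_natCast]; group
  rw [this, Commute.conj_iff]
  cases d with
  | zero => simp
  | succ k => exact h k

namespace HallGroup

variable {S : Set ℕ}

/-- If the conjugates of `u` by powers of `t` commute, then words in `t` and `u` whose values
in `ℤ ≀ ℤ` are trivial have trivial value. -/
theorem lift_eq_one_of_commute {B : Type*} [Group B] (a b : B)
    (h : ∀ k : ℕ, Commute b (a ^ (k + 1) * b * (a ^ (k + 1))⁻¹)) (w : FreeGroup (Fin 2))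
    (hs : (FreeGroup.lift ![(t : HallGroup S), u] w).shift = 0)
    (hp : (FreeGroup.lift ![(t : HallGroup S), u] w).poly = 0) :
    FreeGroup.lift ![a, b] w = 1 := by
  obtain ⟨φ, hφ⟩ := exists_finsupp_hom_of_commute (fun n : ℤ => a ^ n * b * (a ^ n)⁻¹)
    (commute_conj_zpow a b h)
  -- Normal form: appending `t` on the right changes only the shift, appending `u` adds `T shift` to
  -- the polynomial.
  have key : ∀ w ∈ Subgroup.closure (Set.range (FreeGroup.of : Fin 2 → FreeGroup (Fin 2))),
      FreeGroup.lift ![a, b] w =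
        φ (Multiplicative.ofAdd (FreeGroup.lift ![(t : HallGroup S), u] w).poly.coeff) *
          a ^ (FreeGroup.lift ![(t : HallGroup S), u] w).shift := by
    have hT (n : ℤ) : φ (Multiplicative.ofAdd (T n : ℤ[T;T⁻¹]).coeff) = a ^ n * b * (a ^ n)⁻¹ :=
      hφ n
    intro w hw
    induction hw using Subgroup.closure_induction_right with
    | one => simp
    | mul_right x hx y hy ih =>
      obtain ⟨i, rfl⟩ := hy
      rw [map_mul, ih, map_mul]
      fin_cases i
      · simp [zpow_add_one, mul_assoc]
      · simp [hT, mul_assoc]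
    | mul_inv_cancel x hx y hy ih =>
      obtain ⟨i, rfl⟩ := hy
      rw [map_mul, ih, map_mul]
      fin_cases i
      · simp [zpow_sub_one, mul_assoc, ← sub_eq_add_neg]
      · simp [hT, mul_assoc]
  rw [key w (by simp [FreeGroup.closure_range_of]), hs, hp]
  simp

/-- The embedding of the group of functions as the central coordinate. -/
noncomputable def centralHom : Multiplicative ({k : ℕ // k ∉ S} → ℤ) →* HallGroup S where
  toFun c := ⟨0, 0, c.toAdd⟩
  map_one' := rfl
  map_mul' c d := by ext1 <;> simp

/-- A group generated by two elements satisfying the defining relations of the subgroup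
of `HallGroup S` generated by `t` and `u` embeds in `HallGroup S`. -/
theorem injective_of_relations {Q : Type*} [Group Q] (a b : Q)
    (hgen : Function.Surjective (FreeGroup.lift ![a, b]))
    (ha : ∀ k : ℕ, Commute ⁅b, a ^ (k + 1) * b * (a ^ (k + 1))⁻¹⁆ a)
    (hb : ∀ k : ℕ, Commute ⁅b, a ^ (k + 1) * b * (a ^ (k + 1))⁻¹⁆ b)
    (hS : ∀ k ∈ S, ⁅b, a ^ (k + 1) * b * (a ^ (k + 1))⁻¹⁆ = 1)
    (Φ : Q →* HallGroup S) (hΦa : Φ a = t) (hΦb : Φ b = u) : Function.Injective Φ := by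
  set c : ℕ → Q := fun k => ⁅b, a ^ (k + 1) * b * (a ^ (k + 1))⁻¹⁆ with hc
  have hcomm (k : ℕ) (q : Q) : Commute (c k) q := by
    obtain ⟨w, rfl⟩ := hgen q
    induction w using FreeGroup.induction_on with
    | C1 => simp
    | of i => fin_cases i <;> simp [hc, ha, hb]
    | inv_of i ih => rw [map_inv]; exact ih.inv_right
    | mul x y hx hy => rw [map_mul]; exact hx.mul_right hy
  have hle : Subgroup.closure (Set.range c) ≤ Subgroup.center Q := by
    rw [Subgroup.closure_le]
    rintro _ ⟨k, rfl⟩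
    exact Subgroup.mem_center_iff.2 fun g => (hcomm k g).symm.eq
  have hnormal : (Subgroup.closure (Set.range c)).Normal :=
    ⟨fun n hn g => by
      rwa [Subgroup.mem_center_iff.1 (hle hn) g, mul_inv_cancel_right]⟩
  obtain ⟨ψ, hψ⟩ := exists_finsupp_hom_of_commute (fun k : {k : ℕ // k ∉ S} => c k)
    (fun k l => hcomm k _)
  have hψ_range : Subgroup.closure (Set.range c) ≤ ψ.range := by
    rw [Subgroup.closure_le]
    rintro _ ⟨k, rfl⟩
    by_cases hk : k ∈ S
    · rw [show c k = 1 from hS k hk]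
      exact one_mem _
    · exact ⟨_, hψ ⟨k, hk⟩⟩
  -- On the central part, `Φ` is the inclusion of finitely supported functions into all functions,
  -- hence injective.
  have hΦψ : Φ.comp ψ = centralHom.comp
      (AddMonoidHom.toMultiplicative (Finsupp.coeFnAddHom : ({k : ℕ // k ∉ S} →₀ ℤ) →+ _)) := by
    refine Finsupp.mulHom_ext' fun k => MonoidHom.ext_mint ?_
    have : Φ (c k) = ⟨0, 0, Pi.single k 1⟩ := by
      rw [← gapCoeff_T_of_notMem k.2, ← commutator_u_conj]
      simp [hc, hΦa, hΦb, map_commutatorElement]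
    change Φ (ψ (Multiplicative.ofAdd (Finsupp.single k 1))) = ⟨0, 0, ⇑(Finsupp.single k (1 : ℤ))⟩
    rw [hψ, this, Finsupp.single_eq_pi_single]
  refine (injective_iff_map_eq_one Φ).2 fun q hq => ?_
  obtain ⟨w, hw⟩ := hgen q
  have hlift : Φ.comp (FreeGroup.lift ![a, b]) = FreeGroup.lift ![t, u] := by
    ext1 i
    fin_cases i <;> simp [hΦa, hΦb]
  have hw' : FreeGroup.lift ![(t : HallGroup S), u] w = 1 := by
    rw [← hlift, MonoidHom.comp_apply, hw, hq]
  -- Modulo the `c k` the conjugates of `b` commute, so a word trivial in `ℤ ≀ ℤ` dies in the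
  -- quotient.
  have hmem : q ∈ Subgroup.closure (Set.range c) := by
    rw [← QuotientGroup.eq_one_iff, ← hw]
    have := lift_eq_one_of_commute (S := S) (a : Q ⧸ Subgroup.closure (Set.range c)) b
      (fun k => commutatorElement_eq_one_iff_commute.1
        ((QuotientGroup.eq_one_iff (c k)).2 (Subgroup.subset_closure ⟨k, rfl⟩)))
      w (by rw [hw']; rfl) (by rw [hw']; rfl)
    rw [← this]
    have : (QuotientGroup.mk' (Subgroup.closure (Set.range c))).comp (FreeGroup.lift ![a, b]) =
        FreeGroup.lift ![(a : Q ⧸ Subgroup.closure (Set.range c)), b] := by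
      ext1 i
      fin_cases i <;> simp
    exact DFunLike.congr_fun this w
  obtain ⟨e, rfl⟩ := hψ_range hmem
  have := DFunLike.congr_fun hΦψ e
  rw [MonoidHom.comp_apply, hq] at this
  have h0 : e.toAdd = 0 := DFunLike.coe_injective (congrArg central this).symm
  rw [show e = 1 from h0, map_one]

end HallGroup

/-! ### Words -/

section Words

variable {ι : Type*}

/-- A word for the commutator of two words. -/
def commutatorWord (v w : List (ι × Bool)) : List (ι × Bool) :=
  v ++ w ++ FreeGroup.invRev v ++ FreeGroup.invRev w

/-- A word for the commutator of `b` with its conjugate by the `k`-th power of `a`. -/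
def conjCommutatorWord (a b : List (ι × Bool)) (k : ℕ) : List (ι × Bool) :=
  commutatorWord b ((List.replicate k a).flatten ++ b ++
    FreeGroup.invRev (List.replicate k a).flatten)

variable {G : Type*} [Group G] (x : ι → G)

theorem wordValue_append (v w : List (ι × Bool)) :
    wordValue x (v ++ w) = wordValue x v * wordValue x w := by
  rw [wordValue, ← FreeGroup.mul_mk, map_mul]; rfl

theorem wordValue_invRev (w : List (ι × Bool)) :
    wordValue x (FreeGroup.invRev w) = (wordValue x w)⁻¹ := by
  rw [wordValue, ← FreeGroup.inv_mk, map_inv]; rfl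

theorem wordValue_nil : wordValue x [] = 1 :=
  map_one (FreeGroup.lift x)

theorem wordValue_singleton (i : ι) : wordValue x [(i, true)] = x i :=
  FreeGroup.lift_apply_of

theorem wordValue_flatten_replicate (w : List (ι × Bool)) (k : ℕ) :
    wordValue x (List.replicate k w).flatten = wordValue x w ^ k := by
  induction k with
  | zero => simpa using wordValue_nil x
  | succ k ih => rw [List.replicate_succ, List.flatten_cons, wordValue_append, ih, pow_succ']

theorem wordValue_commutatorWord (v w : List (ι × Bool)) :
    wordValue x (commutatorWord v w) = ⁅wordValue x v, wordValue x w⁆ := by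
  simp only [commutatorWord, wordValue_append, wordValue_invRev, commutatorElement_def]

theorem wordValue_conjCommutatorWord (a b : List (ι × Bool)) (k : ℕ) :
    wordValue x (conjCommutatorWord a b k) =
      ⁅wordValue x b, wordValue x a ^ k * wordValue x b * (wordValue x a ^ k)⁻¹⁆ := by
  simp only [conjCommutatorWord, wordValue_commutatorWord, wordValue_append, wordValue_invRev,
    wordValue_flatten_replicate]

variable [Primcodable ι]

theorem primrec_invRev : Primrec (FreeGroup.invRev : List (ι × Bool) → List (ι × Bool)) :=
  Primrec.list_reverse.comp <| Primrec.list_map Primrec.id <|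
    (Primrec.pair (Primrec.fst.comp Primrec.snd)
      (Primrec.not.comp (Primrec.snd.comp Primrec.snd))).to₂

theorem primrec_commutatorWord :
    Primrec₂ (commutatorWord : List (ι × Bool) → List (ι × Bool) → List (ι × Bool)) :=
  Primrec.list_append.comp
    (Primrec.list_append.comp Primrec.list_append (primrec_invRev.comp Primrec.fst))
    (primrec_invRev.comp Primrec.snd)

theorem primrec_flatten_replicate (a : List (ι × Bool)) :
    Primrec fun k => (List.replicate k a).flatten := by
  refine (Primrec.nat_rec₁ (f := fun _ w => a ++ w) []
    (Primrec.list_append.comp (Primrec.const a) Primrec.snd).to₂).of_eq fun k => ?_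
  induction k with
  | zero => rfl
  | succ k ih => rw [List.replicate_succ, List.flatten_cons, ← ih]

theorem primrec_conjCommutatorWord (a b : List (ι × Bool)) :
    Primrec (conjCommutatorWord a b) :=
  primrec_commutatorWord.comp (Primrec.const b) <| Primrec.list_append.comp
    (Primrec.list_append.comp (primrec_flatten_replicate a) (Primrec.const b))
    (primrec_invRev.comp (primrec_flatten_replicate a))

end Words

/-! ### Recursively enumerable sets -/

/-- Unbounded search terminates exactly when a witness exists, since `q` is total. -/
theorem REPred.exists_nat {α : Type*} [Primcodable α] {q : α → ℕ → Bool} (hq : Computable₂ q) :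
    REPred fun a => ∃ n, q a n = true := by
  refine (Partrec.dom_re (Partrec.rfind (p := fun a n => Part.some (q a n)) hq)).of_eq fun a => ?_
  refine Nat.rfind_dom.trans ⟨fun ⟨n, h, _⟩ => ⟨n, (Part.mem_some_iff.1 h).symm⟩, ?_⟩
  exact fun ⟨n, h⟩ => ⟨n, Part.mem_some_iff.2 h.symm, fun _ => trivial⟩

open Nat.Partrec (Code)

/-- The halting set, as a set of natural numbers. -/
def haltingSet : Set ℕ := {k | (Code.eval (Denumerable.ofNat Code k) 0).Dom}

/-- Whether the program `k` is seen to halt with the bound `s`. -/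
def haltsWithin (s k : ℕ) : Bool := (Code.evaln s (Denumerable.ofNat Code k) 0).isSome

theorem mem_haltingSet_iff (k : ℕ) : k ∈ haltingSet ↔ ∃ s, haltsWithin s k = true := by
  simp only [haltingSet, haltsWithin, Set.mem_ofPred_eq, Part.dom_iff_mem, Code.evaln_complete,
    Option.isSome_iff_exists]
  exact exists_comm

theorem primrec_haltsWithin : Primrec₂ haltsWithin :=
  Primrec.option_isSome.comp <| Code.primrec_evaln.comp <|
    Primrec.pair (Primrec.pair Primrec.fst ((Primrec.ofNat Code).comp Primrec.snd))
      (Primrec.const 0)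

theorem not_computablePred_haltingSet : ¬ ComputablePred fun k => k ∈ haltingSet := by
  intro h
  refine ComputablePred.halting_problem 0 ?_
  obtain ⟨f, hf, hf'⟩ := ComputablePred.computable_iff.1 h
  refine ComputablePred.computable_iff.2 ⟨fun c => f (Encodable.encode c),
    hf.comp Computable.encode, ?_⟩
  ext c
  have := congrFun hf' (Encodable.encode c)
  simpa [haltingSet] using this

theorem exists_notMem_haltingSet : ∃ k, k ∉ haltingSet := by
  by_contra! h
  exact not_computablePred_haltingSet <| ComputablePred.computable_iff.2
    ⟨fun _ => true, Computable.const true, by ext k; simp [h k]⟩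

/-! ### The group -/

/-- The canonical homomorphism from the free group of rank two. -/
noncomputable def hallHom : FreeGroup (Fin 2) →* HallGroup haltingSet :=
  FreeGroup.lift ![HallGroup.t, HallGroup.u]

/-- The subgroup of `HallGroup haltingSet` generated by `t` and `u`. -/
abbrev HallSubgroup : Type := hallHom.range

/-- The two generators. -/
noncomputable def hallGen (i : Fin 2) : HallSubgroup := hallHom.rangeRestrict (FreeGroup.of i)

theorem lift_hallGen : FreeGroup.lift hallGen = hallHom.rangeRestrict := by
  ext1 i
  simp [hallGen]

theorem generates_hallGen : Generates hallGen := by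
  rw [Generates, ← FreeGroup.range_lift_eq_closure, lift_hallGen]
  exact MonoidHom.range_eq_top.2 hallHom.rangeRestrict_surjective

theorem subtype_hallGen_zero : hallHom.range.subtype (hallGen 0) = HallGroup.t :=
  FreeGroup.lift_apply_of

theorem subtype_hallGen_one : hallHom.range.subtype (hallGen 1) = HallGroup.u :=
  FreeGroup.lift_apply_of

theorem conjCommutator_hallGen_eq_one_iff (k : ℕ) :
    ⁅hallGen 1, hallGen 0 ^ (k + 1) * hallGen 1 * (hallGen 0 ^ (k + 1))⁻¹⁆ = 1 ↔
      k ∈ haltingSet := by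
  rw [← HallGroup.commutator_u_conj_eq_one_iff,
    ← map_eq_one_iff hallHom.range.subtype Subtype.val_injective]
  simp only [map_commutatorElement, map_mul, map_pow, map_inv, subtype_hallGen_zero,
    subtype_hallGen_one]

/-- Words for the commutators of `u` with its conjugates. -/
def hallWord (k : ℕ) : List (Fin 2 × Bool) := conjCommutatorWord [(0, true)] [(1, true)] (k + 1)

/-- The defining relators. -/
def hallRelators : Set (List (Fin 2 × Bool)) :=
  {w | (∃ k i, w = commutatorWord (hallWord k) [(i, true)]) ∨ ∃ k ∈ haltingSet, w = hallWord k}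

theorem primrec_hallWord : Primrec hallWord :=
  (primrec_conjCommutatorWord _ _).comp Primrec.succ

theorem rePred_hallRelators : REPred fun w => w ∈ hallRelators := by
  -- The witness `n` serves as the index of a centrality relator, or codes a pair of a time bound
  -- and a program that halts within it.
  let q (w : List (Fin 2 × Bool)) (n : ℕ) : Bool :=
    decide (w = commutatorWord (hallWord n) [(0, true)]) ||
      (decide (w = commutatorWord (hallWord n) [(1, true)]) ||
        (haltsWithin n.unpair.1 n.unpair.2 && decide (w = hallWord n.unpair.2)))
  have hc (i : Fin 2) : Primrec fun a : List (Fin 2 × Bool) × ℕ =>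
      decide (a.1 = commutatorWord (hallWord a.2) [(i, true)]) :=
    Primrec.eq.decide.comp Primrec.fst
      (primrec_commutatorWord.comp (primrec_hallWord.comp Primrec.snd) (Primrec.const _))
  have hu : Primrec fun a : List (Fin 2 × Bool) × ℕ => a.2.unpair :=
    Primrec.unpair.comp Primrec.snd
  have hq : Primrec₂ q := Primrec.or.comp (hc 0) <| Primrec.or.comp (hc 1) <| Primrec.and.comp
    (primrec_haltsWithin.comp (Primrec.fst.comp hu) (Primrec.snd.comp hu))
    (Primrec.eq.decide.comp Primrec.fst (primrec_hallWord.comp (Primrec.snd.comp hu)))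
  refine (REPred.exists_nat hq.to_comp).of_eq fun w => ?_
  simp only [q, Bool.or_eq_true, Bool.and_eq_true, decide_eq_true_eq, hallRelators,
    Set.mem_ofPred_eq, mem_haltingSet_iff, Fin.exists_fin_two]
  constructor
  · rintro ⟨n, h | h | h⟩
    exacts [Or.inl ⟨n, Or.inl h⟩, Or.inl ⟨n, Or.inr h⟩, Or.inr ⟨_, ⟨_, h.1⟩, h.2⟩]
  · rintro (⟨n, h | h⟩ | ⟨k, ⟨s, hs⟩, h⟩)
    exacts [⟨n, Or.inl h⟩, ⟨n, Or.inr (Or.inl h)⟩,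
      ⟨Nat.pair s k, Or.inr (Or.inr (by simpa using ⟨hs, h⟩))⟩]

theorem wordValue_hallWord {G : Type*} [Group G] (x : Fin 2 → G) (k : ℕ) :
    wordValue x (hallWord k) = ⁅x 1, x 0 ^ (k + 1) * x 1 * (x 0 ^ (k + 1))⁻¹⁆ := by
  simp only [hallWord, wordValue_conjCommutatorWord, wordValue_singleton]

theorem normalClosure_hallRelators :
    Subgroup.normalClosure (FreeGroup.mk '' hallRelators) = hallHom.ker := by
  have hle : Subgroup.normalClosure (FreeGroup.mk '' hallRelators) ≤ hallHom.ker := by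
    refine Subgroup.normalClosure_le_normal ?_
    rintro _ ⟨w, ⟨k, i, rfl⟩ | ⟨k, hk, rfl⟩, rfl⟩
    · change wordValue _ _ = 1
      rw [wordValue_commutatorWord, wordValue_hallWord, commutatorElement_eq_one_iff_commute]
      exact HallGroup.commute_of_central _ _ (congrArg _ (HallGroup.commutator_u_conj k))
        (congrArg HallGroup.poly (HallGroup.commutator_u_conj k))
    · change wordValue _ _ = 1
      rw [wordValue_hallWord]
      exact (HallGroup.commutator_u_conj_eq_one_iff k).2 hk
  refine le_antisymm hle fun w hw => ?_
  set N := Subgroup.normalClosure (FreeGroup.mk '' hallRelators) with hN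
  let x : Fin 2 → FreeGroup (Fin 2) ⧸ N := fun i => (FreeGroup.of i : FreeGroup (Fin 2))
  have hx : FreeGroup.lift ![x 0, x 1] = QuotientGroup.mk' N := by
    ext1 i
    fin_cases i <;> simp [x]
  have hx' : FreeGroup.lift x = QuotientGroup.mk' N := by
    ext1 i
    simp [x]
  have hrel (v) (hv : v ∈ hallRelators) : wordValue x v = 1 := by
    rw [wordValue, hx']
    exact (QuotientGroup.eq_one_iff _).2 (Subgroup.subset_normalClosure ⟨v, hv, rfl⟩)
  have hcomm (k : ℕ) (i : Fin 2) :
      Commute ⁅x 1, x 0 ^ (k + 1) * x 1 * (x 0 ^ (k + 1))⁻¹⁆ (x i) := by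
    have := hrel _ (Or.inl ⟨k, i, rfl⟩)
    rwa [wordValue_commutatorWord, wordValue_hallWord, wordValue_singleton,
      commutatorElement_eq_one_iff_commute] at this
  -- Injectivity of the map induced by `hallHom` on the quotient by `N` is the inclusion of its
  -- kernel in `N`.
  have hinj := HallGroup.injective_of_relations (S := haltingSet) (x 0) (x 1)
    (by rw [hx]; exact QuotientGroup.mk'_surjective N) (fun k => hcomm k 0) (fun k => hcomm k 1)
    (fun k hk => by rw [← wordValue_hallWord]; exact hrel _ (Or.inr ⟨k, hk, rfl⟩))
    (QuotientGroup.lift N hallHom hle) (by simp [x, hallHom]) (by simp [x, hallHom])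
  rw [← QuotientGroup.eq_one_iff]
  refine hinj ?_
  rw [map_one]
  exact hw

theorem hasRecursivePresentation_hallGen : HasRecursivePresentation hallGen :=
  ⟨generates_hallGen, hallRelators, rePred_hallRelators, by
    rw [normalClosure_hallRelators, lift_hallGen, MonoidHom.ker_rangeRestrict]⟩

theorem IsBiOrderable.subgroup {G : Type*} [Group G] (h : IsBiOrderable G) (H : Subgroup G) :
    IsBiOrderable H := by
  obtain ⟨_, h⟩ := h
  exact ⟨inferInstance, fun a b c hab => h a b c hab⟩

theorem isSolvableOfDerivedLength_hallSubgroup : IsSolvableOfDerivedLength HallSubgroup 3 := by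
  constructor
  · rw [eq_bot_iff, ← Subgroup.map_subtype_le_map_subtype, Subgroup.map_bot,
      ← HallGroup.derivedSeries_three (S := haltingSet)]
    exact map_derivedSeries_le_derivedSeries _ 3
  · intro k hk hbot
    have h2 : derivedSeries HallSubgroup 2 = ⊥ :=
      eq_bot_iff.2 (hbot ▸ derivedSeries_antitone HallSubgroup (Nat.le_of_lt_succ hk))
    obtain ⟨j, hj⟩ := exists_notMem_haltingSet
    have h1 : ⁅hallGen 0, hallGen 1⁆ ∈ derivedSeries HallSubgroup 1 := by
      rw [derivedSeries_one]
      exact Subgroup.commutator_mem_commutator (Subgroup.mem_top _) (Subgroup.mem_top _)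
    have h : ⁅⁅hallGen 0, hallGen 1⁆,
        hallGen 0 ^ (j + 1) * ⁅hallGen 0, hallGen 1⁆ * (hallGen 0 ^ (j + 1))⁻¹⁆ ∈
          derivedSeries HallSubgroup 2 :=
      Subgroup.commutator_mem_commutator h1 ((derivedSeries_normal _ _).conj_mem _ h1 _)
    rw [h2, Subgroup.mem_bot, ← map_eq_one_iff hallHom.range.subtype Subtype.val_injective] at h
    refine HallGroup.double_commutator_ne_one hj ?_
    simpa only [map_commutatorElement, map_mul, map_pow, map_inv, subtype_hallGen_zero,
      subtype_hallGen_one] using h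

/-- Fixed words for `t` and `u` in the given generators turn `k` computably into a word that is
trivial exactly when program `k` halts. -/
theorem not_hasDecidableWordProblem_hallSubgroup : ¬ HasDecidableWordProblem HallSubgroup := by
  rintro ⟨n, y, hy, hdec⟩
  have hsurj (g : HallSubgroup) : ∃ w, wordValue y w = g := by
    have : g ∈ (FreeGroup.lift y).range := by
      rw [FreeGroup.range_lift_eq_closure, show Subgroup.closure (Set.range y) = ⊤ from hy]
      exact Subgroup.mem_top g
    obtain ⟨w, rfl⟩ := this
    exact ⟨w.toWord, by rw [wordValue, FreeGroup.mk_toWord]⟩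
  obtain ⟨a, ha⟩ := hsurj (hallGen 0)
  obtain ⟨b, hb⟩ := hsurj (hallGen 1)
  obtain ⟨f, hf, hf'⟩ := ComputablePred.computable_iff.1 hdec
  refine not_computablePred_haltingSet <| ComputablePred.computable_iff.2
    ⟨fun k => f (conjCommutatorWord a b (k + 1)),
      hf.comp ((primrec_conjCommutatorWord a b).comp Primrec.succ).to_comp, ?_⟩
  ext k
  rw [← conjCommutator_hallGen_eq_one_iff, ← congrFun hf', wordValue_conjCommutatorWord, ha, hb]

theorem theorem2 :
    ∃ (G : Type) (_ : Group G) (x : Fin 2 → G),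
      Generates x ∧
      HasRecursivePresentation x ∧
      IsBiOrderable G ∧
      IsSolvableOfDerivedLength G 3 ∧
      ¬ HasDecidableWordProblem G :=
  ⟨HallSubgroup, inferInstance, hallGen, generates_hallGen, hasRecursivePresentation_hallGen,
    HallGroup.isBiOrderable.subgroup _, isSolvableOfDerivedLength_hallSubgroup,
    not_hasDecidableWordProblem_hallSubgroup⟩
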